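/- Let $I\subseteq\mathbb R$ be an open interval (bounded or unbounded), let $f:I\to\mathbb R$ and let $n\ge 2$. Call $f$ *$n$-monotone* if $f(A)\le f(B)$ for all complex Hermitian $n\times n$ matrices $A\le B$ with spectra in $I$, and *$n$-convex* if $f(tA+(1-t)B)\le t f(A)+(1-t)f(B)$ for all complex Hermitian $n\times n$ matrices $A,B$ with spectra in $I$ and all $t\in[0,1]$; here $\le$ is the Loewner order and $f(A)$ is given by the functional calculus. The divided differences of $f$ at pairwise distinct points of $I$ are given by $[x_0]_f=f(x_0)$ and $$[x_0,\dots,x_k]_f=\frac{[x_0,\dots,x_{k-1}]_f-[x_1,\dots,x_k]_f}{x_0-x_k}.$$ Call $f$ *$k$-tone* if $[x_0,\dots,x_k]_f\ge 0$ for all pairwise distinct $x_0,\dots,x_k\in I$. 1. If $f$ is $n$-monotone, then $f$ is $(2n-1)$-tone, $f\in C^{2n-3}(I)$, $f^{(2n-3)}$ is convex on $I$, and $f^{(2n-1)}$ exists and is non-negative almost everywhere on $I$. The last assertion means: if $D\subseteq I$ is the set of points at which $f^{(2n-3)}$ is differentiable, then almost every $t\in I$ lies in $D$ and the function $f^{(2n-2)}:D\to\mathbb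 R$ has at $t$ a derivative (relative to $D$), which is non-negative. 2. If $f$ is $n$-convex, then $f$ is $(2n)$-tone and $f\in C^{2n-2}(I)$. -/

import Mathlib

open MeasureTheory
open scoped ComplexOrder MatrixOrder

/-- The divided difference `[x 0, …, x k]_f` of order `k`, by the usual recursion
(meant for pairwise distinct nodes). -/
noncomputable def dividedDifference (f : ℝ → ℝ) : (k : ℕ) → (Fin (k + 1) → ℝ) → ℝ
  | 0, x => f (x 0)
  | k + 1, x =>
      (dividedDifference f k (fun i : Fin (k + 1) => x i.castSucc) -
        dividedDifference f k (fun i : Fin (k + 1) => x i.succ)) / (x 0 - x (Fin.last (k + 1)))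

/-- `f` is `k`-tone on `I`: all its divided differences of order `k` over pairwise distinct
points of `I` are non-negative. -/
def IsToneOn (k : ℕ) (I : Set ℝ) (f : ℝ → ℝ) : Prop :=
  ∀ x : Fin (k + 1) → ℝ, Function.Injective x → (∀ i, x i ∈ I) → 0 ≤ dividedDifference f k x

/-- `f` is `n`-monotone on `I`: for all complex Hermitian `n × n` matrices `A ≤ B` (Loewner order)
with spectra in `I` one has `f(A) ≤ f(B)`. For `I = (a, b)` and Hermitian `A`, the condition
`spec A ⊆ I` says `a I < A < b I`. The matrix `cfc f A` is `f(A)` (every function is continuous on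
a finite spectrum), and it depends only on the restriction of `f` to the spectrum of `A`. -/
def IsMatrixMonotoneOn (n : ℕ) (I : Set ℝ) (f : ℝ → ℝ) : Prop :=
  ∀ A B : Matrix (Fin n) (Fin n) ℂ, A.IsHermitian → B.IsHermitian →
    spectrum ℝ A ⊆ I → spectrum ℝ B ⊆ I →
    A ≤ B → cfc f A ≤ cfc f B

/-- `f` is `n`-convex on the interval `I`: `f(tA + (1-t)B) ≤ t f(A) + (1-t) f(B)` in the Loewner
order for all complex Hermitian `n × n` matrices `A`, `B` with spectra in `I` and `t ∈ [0, 1]`. -/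
def IsMatrixConvexOn (n : ℕ) (I : Set ℝ) (f : ℝ → ℝ) : Prop :=
  ∀ A B : Matrix (Fin n) (Fin n) ℂ, A.IsHermitian → B.IsHermitian →
    spectrum ℝ A ⊆ I → spectrum ℝ B ⊆ I →
    ∀ t : ℝ, 0 ≤ t → t ≤ 1 →
      cfc f (t • A + (1 - t) • B) ≤ t • cfc f A + (1 - t) • cfc f B

/-- The divided difference of `f` over a finite set of nodes, in symmetric form. -/
noncomputable def divDiff (f : ℝ → ℝ) (s : Finset ℝ) : ℝ :=
  ∑ a ∈ s, f a * ∏ b ∈ s.erase a, (a - b)⁻¹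

theorem divDiff_singleton (f : ℝ → ℝ) (a : ℝ) : divDiff f {a} = f a := by
  simp [divDiff]

theorem divDiff_insert (f : ℝ → ℝ) {s : Finset ℝ} {a : ℝ} (ha : a ∉ s) :
    divDiff f (insert a s) = f a * ∏ b ∈ s, (a - b)⁻¹ +
      ∑ c ∈ s, f c * ((c - a)⁻¹ * ∏ b ∈ s.erase c, (c - b)⁻¹) := by
  unfold divDiff
  rw [Finset.sum_insert ha, Finset.erase_insert ha]
  congr 1
  refine Finset.sum_congr rfl fun c hc => ?_
  have hac : a ≠ c := fun h => ha (h ▸ hc)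
  rw [Finset.erase_insert_of_ne hac, Finset.prod_insert (fun h => ha (Finset.mem_of_mem_erase h))]

theorem divDiff_insert_sub_insert (f : ℝ → ℝ) {s : Finset ℝ} {a b : ℝ} (ha : a ∉ s) (hb : b ∉ s)
    (hab : a ≠ b) :
    divDiff f (insert a s) - divDiff f (insert b s) =
      (a - b) * divDiff f (insert a (insert b s)) := by
  have hab' : a ∉ insert b s := by simp [hab, ha]
  have h0 : a - b ≠ 0 := sub_ne_zero.2 hab
  have h1 : b - a ≠ 0 := sub_ne_zero.2 hab.symm
  rw [divDiff_insert f hab', divDiff_insert f ha, divDiff_insert f hb, Finset.sum_insert hb,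
    Finset.prod_insert hb, Finset.erase_insert hb]
  have key : ∀ c ∈ s, f c * ((c - a)⁻¹ * ∏ x ∈ (insert b s).erase c, (c - x)⁻¹) * (a - b) =
      f c * ((c - a)⁻¹ * ∏ x ∈ s.erase c, (c - x)⁻¹) -
        f c * ((c - b)⁻¹ * ∏ x ∈ s.erase c, (c - x)⁻¹) := by
    intro c hc
    have hca : c - a ≠ 0 := sub_ne_zero.2 fun h => ha (h ▸ hc)
    have hcb : c - b ≠ 0 := sub_ne_zero.2 fun h => hb (h ▸ hc)
    rw [Finset.erase_insert_of_ne (fun h : b = c => hb (h ▸ hc)),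
      Finset.prod_insert (fun h => hb (Finset.mem_of_mem_erase h))]
    field_simp
    ring
  have hsum := Finset.sum_congr rfl key
  rw [← Finset.sum_mul, Finset.sum_sub_distrib] at hsum
  have e1 : (a - b) * (f a * ((a - b)⁻¹ * ∏ b ∈ s, (a - b)⁻¹)) = f a * ∏ b ∈ s, (a - b)⁻¹ := by
    field_simp
  have e2 : (a - b) * (f b * ((b - a)⁻¹ * ∏ c ∈ s, (b - c)⁻¹)) = -(f b * ∏ c ∈ s, (b - c)⁻¹) := by
    rw [← neg_sub b a]
    field_simp
  rw [mul_add, mul_add, e1, e2]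
  linarith

theorem dividedDifference_eq_divDiff (f : ℝ → ℝ) (k : ℕ) (x : Fin (k + 1) → ℝ)
    (hx : Function.Injective x) :
    dividedDifference f k x = divDiff f (Finset.univ.image x) := by
  induction k with
  | zero => simp [dividedDifference, divDiff_singleton]
  | succ k ih =>
    have hcs : Function.Injective fun i : Fin (k + 1) => x i.castSucc :=
      hx.comp (Fin.castSucc_injective _)
    have hsc : Function.Injective fun i : Fin (k + 1) => x i.succ :=
      hx.comp (Fin.succ_injective _)
    set m : Finset ℝ := Finset.univ.image fun i : Fin k => x i.castSucc.succ with hm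
    have h0 : x 0 ∉ m := by
      simp only [hm, Finset.mem_image, Finset.mem_univ, true_and, not_exists]
      intro i h
      exact Fin.succ_ne_zero _ (hx h)
    have hl : x (Fin.last (k + 1)) ∉ m := by
      simp only [hm, Finset.mem_image, Finset.mem_univ, true_and, not_exists]
      intro i h
      have := hx h
      rw [← Fin.succ_last, Fin.succ_inj] at this
      exact (Fin.castSucc_lt_last i).ne this
    have h0l : x 0 ≠ x (Fin.last (k + 1)) := fun h => by
      have := hx h
      simp [Fin.ext_iff] at this
    have e1 : (Finset.univ.image fun i : Fin (k + 1) => x i.castSucc) = insert (x 0) m := by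
      ext y
      simp [hm, Fin.exists_fin_succ, eq_comm]
    have e2 : (Finset.univ.image fun i : Fin (k + 1) => x i.succ) =
        insert (x (Fin.last (k + 1))) m := by
      ext y
      simp only [hm, Finset.mem_image, Finset.mem_univ, true_and, Finset.mem_insert,
        Fin.exists_fin_succ', Fin.succ_castSucc, Fin.succ_last]
      tauto
    have e3 : Finset.univ.image x = insert (x 0) (insert (x (Fin.last (k + 1))) m) := by
      rw [← e2]
      ext y
      simp [Fin.exists_fin_succ, eq_comm]
    rw [dividedDifference, ih _ hcs, ih _ hsc, e1, e2, e3, divDiff_insert_sub_insert f h0 hl h0l,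
      mul_div_cancel_left₀ _ (sub_ne_zero.2 h0l)]

theorem isToneOn_iff_divDiff_nonneg {k : ℕ} {I : Set ℝ} {f : ℝ → ℝ} :
    IsToneOn k I f ↔ ∀ s : Finset ℝ, s.card = k + 1 → ↑s ⊆ I → 0 ≤ divDiff f s := by
  constructor
  · intro h s hs hI
    have := h (s.orderEmbOfFin hs) (s.orderEmbOfFin hs).injective
      fun i => hI (s.orderEmbOfFin_mem hs i)
    rwa [dividedDifference_eq_divDiff _ _ _ (s.orderEmbOfFin hs).injective,
      Finset.image_orderEmbOfFin_univ] at this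
  · intro h x hx hI
    rw [dividedDifference_eq_divDiff _ _ _ hx]
    refine h _ ?_ ?_
    · rw [Finset.card_image_of_injective _ hx, Finset.card_univ, Fintype.card_fin]
    · intro y hy
      simp only [Finset.coe_image, Set.mem_image] at hy
      obtain ⟨i, -, rfl⟩ := hy
      exact hI i

theorem divDiff_image (f : ℝ → ℝ) {s : Finset ℝ} {u : ℝ → ℝ} (hu : Set.InjOn u s) :
    divDiff f (s.image u) = ∑ a ∈ s, f (u a) * ∏ b ∈ s.erase a, (u a - u b)⁻¹ := by
  unfold divDiff
  rw [Finset.sum_image hu]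
  refine Finset.sum_congr rfl fun a ha => ?_
  have : (s.image u).erase (u a) = (s.erase a).image u := by
    ext y
    simp only [Finset.mem_erase, Finset.mem_image]
    constructor
    · rintro ⟨hy, b, hb, rfl⟩
      exact ⟨b, ⟨fun h => hy (h ▸ rfl), hb⟩, rfl⟩
    · rintro ⟨b, ⟨hba, hb⟩, rfl⟩
      exact ⟨fun h => hba (hu hb ha h), b, hb, rfl⟩
  rw [this, Finset.prod_image (hu.mono (by simp))]

theorem divDiff_one {s : Finset ℝ} (hs : 2 ≤ s.card) : divDiff (fun _ => 1) s = 0 := by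
  obtain ⟨m, hm⟩ := Nat.exists_eq_add_of_le hs
  induction m generalizing s with
  | zero =>
    obtain ⟨a, b, hab, rfl⟩ := Finset.card_eq_two.1 hm
    have := divDiff_insert_sub_insert (fun _ => 1) (Finset.notMem_empty a)
      (Finset.notMem_empty b) hab
    simp only [insert_empty_eq, divDiff_singleton, sub_self] at this
    exact (mul_eq_zero.1 this.symm).resolve_left (sub_ne_zero.2 hab)
  | succ m ih =>
    obtain ⟨a, b, ha, hb, hab⟩ := Finset.one_lt_card_iff.1 (show 1 < s.card by omega)
    have hba : b ∈ s.erase a := by simp [hb, hab.symm]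
    set t := (s.erase a).erase b
    have hat : a ∉ t := by simp [t]
    have hbt : b ∉ t := by simp [t]
    have hst : s = insert a (insert b t) := by
      rw [Finset.insert_erase hba, Finset.insert_erase ha]
    have hct : t.card = m + 1 := by
      rw [Finset.card_erase_of_mem hba, Finset.card_erase_of_mem ha]; omega
    have := divDiff_insert_sub_insert (fun _ => 1) hat hbt hab
    rw [ih (by rw [Finset.card_insert_of_notMem hat]; omega)
      (by rw [Finset.card_insert_of_notMem hat]; omega),
      ih (by rw [Finset.card_insert_of_notMem hbt]; omega)
      (by rw [Finset.card_insert_of_notMem hbt]; omega), ← hst, sub_self] at this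
    exact (mul_eq_zero.1 this.symm).resolve_left (sub_ne_zero.2 hab)

/-- If divided differences of order one more are at least `-M`, moving nodes to the right
decreases the divided difference by at most `M` times the total displacement. -/
theorem divDiff_sub_divDiff_image_le {f : ℝ → ℝ} {J : Set ℝ} {M : ℝ} {k : ℕ}
    (hM : ∀ s : Finset ℝ, s.card = k + 1 → ↑s ⊆ J → -M ≤ divDiff f s)
    {φ : ℝ → ℝ} (s r : Finset ℝ) (hφ : Set.InjOn φ s) (hlt : ∀ a ∈ s, a < φ a)
    (hs : ↑s ⊆ J) (hr : ↑r ⊆ J) (hφJ : ∀ a ∈ s, φ a ∈ J)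
    (hsr : Disjoint s r) (hφr : Disjoint (s.image φ) r) (hsφ : Disjoint s (s.image φ))
    (hcard : s.card + r.card = k) :
    divDiff f (s ∪ r) - divDiff f (s.image φ ∪ r) ≤ M * ∑ a ∈ s, (φ a - a) := by
  induction s using Finset.induction_on generalizing r with
  | empty => simp
  | insert a s ha ih =>
    have hφa : φ a ∉ s.image φ := by
      intro h
      obtain ⟨b, hb, hab⟩ := Finset.mem_image.1 h
      exact ha (hφ (by simp [hb]) (by simp) hab ▸ hb)
    simp only [Finset.image_insert, Finset.disjoint_insert_left, Finset.disjoint_insert_right,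
      Finset.mem_insert, not_or, Finset.mem_image, not_exists, not_and] at hsr hφr hsφ hφa
    simp only [Finset.mem_insert, forall_eq_or_imp] at hlt hφJ
    rw [Finset.coe_insert, Set.insert_subset_iff] at hs
    have step := ih (insert (φ a) r) (hφ.mono (by simp)) hlt.2 hs.2
      (by rw [Finset.coe_insert]; exact Set.insert_subset hφJ.1 hr) hφJ.2
      (by simp only [Finset.disjoint_insert_right]; exact ⟨hsφ.1.2, hsr.2⟩)
      (by
        simp only [Finset.disjoint_insert_right, Finset.mem_image, not_exists, not_and]
        exact ⟨hφa, hφr.2⟩)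
      hsφ.2.2
      (by
        rw [Finset.card_insert_of_notMem hφr.1]
        rw [Finset.card_insert_of_notMem ha] at hcard
        omega)
    have ha' : a ∉ s ∪ r := by simp [ha, hsr.1]
    have hφa' : φ a ∉ s ∪ r := by simp [hsφ.1.2, hφr.1]
    have hne : a ≠ φ a := hlt.1.ne
    have key := divDiff_insert_sub_insert f ha' hφa' hne
    have hb := hM (insert a (insert (φ a) (s ∪ r)))
      (by
        rw [Finset.card_insert_of_notMem (by simp [ha, hsr.1, hne]),
          Finset.card_insert_of_notMem hφa', Finset.card_union_of_disjoint hsr.2]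
        rw [Finset.card_insert_of_notMem ha] at hcard
        omega)
      (by
        simp only [Finset.coe_insert, Finset.coe_union]
        exact Set.insert_subset hs.1 (Set.insert_subset hφJ.1 (Set.union_subset hs.2 hr)))
    rw [Finset.sum_insert ha, Finset.image_insert, Finset.insert_union, Finset.insert_union]
    rw [Finset.union_insert, Finset.union_insert] at step
    have := mul_le_mul_of_nonneg_left hb (sub_nonneg.2 hlt.1.le)
    have e : (a - φ a) * divDiff f (insert a (insert (φ a) (s ∪ r))) =
      -((φ a - a) * divDiff f (insert a (insert (φ a) (s ∪ r)))) := by ring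
    rw [e] at key
    linarith

theorem sub_mul_divDiff_pair (f : ℝ → ℝ) {a b : ℝ} (hab : a ≠ b) :
    (a - b) * divDiff f {a, b} = f a - f b := by
  have := divDiff_insert_sub_insert f (Finset.notMem_empty a) (Finset.notMem_empty b) hab
  simpa [divDiff_singleton] using this.symm

theorem slope_eq_divDiff_pair (f : ℝ → ℝ) {a b : ℝ} (hab : a ≠ b) :
    slope f a b = divDiff f {b, a} := by
  have h := sub_mul_divDiff_pair f hab.symm
  rw [slope_def_field, ← h, mul_div_cancel_left₀ _ (sub_ne_zero.2 hab.symm)]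

theorem Finset.exists_injOn_image_eq_of_card_eq {s t : Finset ℝ} (h : s.card = t.card) :
    ∃ φ : ℝ → ℝ, Set.InjOn φ s ∧ s.image φ = t := by
  let e := Finset.equivOfCardEq h
  refine ⟨fun a => if ha : a ∈ s then e ⟨a, ha⟩ else 0, ?_, ?_⟩
  · intro a ha b hb hab
    have ha' : a ∈ s := ha
    have hb' : b ∈ s := hb
    simp only [ha', hb', dif_pos] at hab
    simpa using e.injective (Subtype.ext hab)
  · ext y
    simp only [Finset.mem_image]
    constructor
    · rintro ⟨a, ha, rfl⟩
      simp [ha]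
    · intro hy
      exact ⟨e.symm ⟨y, hy⟩, (e.symm ⟨y, hy⟩).2, by simp⟩

theorem exists_Icc_subset_of_isOpen {I : Set ℝ} (hI : IsOpen I) {x : ℝ} (hx : x ∈ I) :
    ∃ ε > 0, Set.Icc (x - ε) (x + ε) ⊆ I := by
  obtain ⟨ε, hε, h⟩ := Metric.nhds_basis_closedBall.mem_iff.1 (hI.mem_nhds hx)
  exact ⟨ε, hε, by rwa [← Real.closedBall_eq_Icc]⟩

theorem exists_Icc_superset {I : Set ℝ} (hI : IsOpen I) (hc : I.OrdConnected) {a b : ℝ}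
    (hab : a ≤ b) (h : Set.Icc a b ⊆ I) : ∃ a' b', a' < a ∧ b < b' ∧ Set.Icc a' b' ⊆ I := by
  obtain ⟨ε, hε, h1⟩ := exists_Icc_subset_of_isOpen hI (h (Set.left_mem_Icc.2 hab))
  obtain ⟨δ, hδ, h2⟩ := exists_Icc_subset_of_isOpen hI (h (Set.right_mem_Icc.2 hab))
  exact ⟨a - ε, b + δ, by linarith, by linarith,
    hc.out (h1 ⟨le_rfl, by linarith⟩) (h2 ⟨by linarith, le_rfl⟩)⟩

/-- Lower bounds for divided differences of order `k + 1` on compact intervals give two-sided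
bounds for those of order `k`. -/
theorem divDiff_locally_bounded {I : Set ℝ} (hI : IsOpen I) (hc : I.OrdConnected) {f : ℝ → ℝ}
    {k : ℕ}
    (h : ∀ a b, Set.Icc a b ⊆ I →
      ∃ M, ∀ s : Finset ℝ, s.card = k + 2 → ↑s ⊆ Set.Icc a b → -M ≤ divDiff f s)
    (a b : ℝ) (hab : Set.Icc a b ⊆ I) :
    ∃ M, ∀ s : Finset ℝ, s.card = k + 1 → ↑s ⊆ Set.Icc a b → |divDiff f s| ≤ M := by
  rcases lt_or_ge b a with hlt | hle
  · refine ⟨0, fun s hs hsub => ?_⟩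
    rw [Set.Icc_eq_empty (not_le.2 hlt), Set.subset_empty_iff, Finset.coe_eq_empty] at hsub
    simp [hsub] at hs
  obtain ⟨a', b', ha', hb', hI'⟩ := exists_Icc_superset hI hc hle hab
  obtain ⟨M₀, hM₀⟩ := h a' b' hI'
  set M := max M₀ 0
  have hM : ∀ s : Finset ℝ, s.card = k + 1 + 1 → ↑s ⊆ Set.Icc a' b' → -M ≤ divDiff f s :=
    fun s hs hsub => (neg_le_neg (le_max_left _ _)).trans (hM₀ s hs hsub)
  have hM0 : 0 ≤ M := le_max_right _ _
  obtain ⟨p, hp, hpc⟩ := (Set.Ico_infinite ha').exists_subset_card_eq (k + 1)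
  obtain ⟨q, hq, hqc⟩ := (Set.Ioc_infinite hb').exists_subset_card_eq (k + 1)
  have hbound : ∀ (u v : Finset ℝ), u.card = k + 1 → v.card = k + 1 → ↑u ⊆ Set.Icc a' b' →
      ↑v ⊆ Set.Icc a' b' → (∀ x ∈ u, ∀ y ∈ v, x < y) →
      divDiff f u - divDiff f v ≤ M * ((k + 1 : ℕ) * (b' - a')) := by
    intro u v hu hv hu' hv' huv
    obtain ⟨φ, hφ, rfl⟩ := Finset.exists_injOn_image_eq_of_card_eq (hu.trans hv.symm)
    have hmem : ∀ x ∈ u, φ x ∈ u.image φ := fun x hx => Finset.mem_image_of_mem φ hx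
    have := divDiff_sub_divDiff_image_le hM u ∅ hφ (fun x hx => huv x hx _ (hmem x hx)) hu'
      (by simp) (fun x hx => hv' (hmem x hx)) (by simp) (by simp)
      (Finset.disjoint_left.2 fun x hx hx' => lt_irrefl _ (huv x hx x hx')) (by simpa using hu)
    rw [Finset.union_empty, Finset.union_empty] at this
    refine this.trans (mul_le_mul_of_nonneg_left ?_ hM0)
    rw [← hu, ← nsmul_eq_mul]
    refine Finset.sum_le_card_nsmul _ _ _ fun x hx => ?_
    have h1 := hu' hx
    have h2 := hv' (hmem x hx)
    linarith [h1.1, h2.2]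
  refine ⟨|divDiff f p| + |divDiff f q| + M * ((k + 1 : ℕ) * (b' - a')), fun s hs hsub => ?_⟩
  have hs' : (s : Set ℝ) ⊆ Set.Icc a' b' := hsub.trans (Set.Icc_subset_Icc ha'.le hb'.le)
  have h1 := hbound p s hpc hs (hp.trans fun x hx => ⟨hx.1, by linarith [hx.2]⟩) hs'
    fun x hx y hy => (hp hx).2.trans_le (hsub hy).1
  have h2 := hbound s q hs hqc hs' (hq.trans fun x hx => ⟨by linarith [hx.1], hx.2⟩)
    fun x hx y hy => (hsub hx).2.trans_lt (hq hy).1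
  rw [abs_le]
  constructor <;> linarith [le_abs_self (divDiff f q), neg_abs_le (divDiff f p),
    abs_nonneg (divDiff f q), abs_nonneg (divDiff f p)]

theorem IsToneOn.divDiff_two_locally_bounded {I : Set ℝ} (hI : IsOpen I) (hc : I.OrdConnected)
    {f : ℝ → ℝ} {k : ℕ} (hf : IsToneOn (k + 3) I f) (a b : ℝ) (hab : Set.Icc a b ⊆ I) :
    ∃ M, ∀ s : Finset ℝ, s.card = 3 → ↑s ⊆ Set.Icc a b → |divDiff f s| ≤ M := by
  have key : ∀ m : ℕ, (∀ a b, Set.Icc a b ⊆ I →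
      ∃ M, ∀ s : Finset ℝ, s.card = m + 4 → ↑s ⊆ Set.Icc a b → -M ≤ divDiff f s) →
      ∀ a b, Set.Icc a b ⊆ I →
      ∃ M, ∀ s : Finset ℝ, s.card = 3 → ↑s ⊆ Set.Icc a b → |divDiff f s| ≤ M := by
    intro m
    induction m with
    | zero => exact divDiff_locally_bounded hI hc
    | succ m ih =>
      intro h
      refine ih fun a b hab => ?_
      obtain ⟨M, hM⟩ := divDiff_locally_bounded hI hc (k := m + 3) h a b hab
      exact ⟨M, fun s hs hsub => (abs_le.1 (hM s hs hsub)).1⟩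
  refine key k (fun a b hab => ⟨0, fun s hs hsub => ?_⟩) a b hab
  rw [neg_zero]
  exact isToneOn_iff_divDiff_nonneg.1 hf s hs (hsub.trans hab)

theorem IsToneOn.differentiableAt {I : Set ℝ} (hI : IsOpen I) (hc : I.OrdConnected)
    {f : ℝ → ℝ} {k : ℕ} (hf : IsToneOn (k + 3) I f) {x : ℝ} (hx : x ∈ I) :
    DifferentiableAt ℝ f x := by
  obtain ⟨ε, hε, hsub⟩ := exists_Icc_subset_of_isOpen hI hx
  obtain ⟨M, hM⟩ := hf.divDiff_two_locally_bounded hI hc _ _ hsub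
  have hxJ : x ∈ Set.Icc (x - ε) (x + ε) := ⟨by linarith, by linarith⟩
  have hlip : LipschitzOnWith M.toNNReal (slope f x) (Set.Icc (x - ε) (x + ε) \ {x}) := by
    refine LipschitzOnWith.of_dist_le_mul fun y hy z hz => ?_
    rcases eq_or_ne y z with rfl | hyz
    · simp
    have hyx : y ≠ x := hy.2
    have hzx : z ≠ x := hz.2
    have h := divDiff_insert_sub_insert f (s := {x}) (by simpa using hyx) (by simpa using hzx) hyz
    rw [Real.dist_eq, Real.dist_eq, slope_eq_divDiff_pair f hyx.symm,
      slope_eq_divDiff_pair f hzx.symm, h, abs_mul, mul_comm]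
    refine mul_le_mul_of_nonneg_right ((hM _ ?_ ?_).trans (Real.le_coe_toNNReal M)) (abs_nonneg _)
    · exact Finset.card_eq_three.2 ⟨y, z, x, hyz, hyx, hzx, rfl⟩
    · intro w hw
      simp only [Finset.coe_insert, Finset.coe_singleton, Set.mem_insert_iff,
        Set.mem_singleton_iff] at hw
      rcases hw with rfl | rfl | rfl
      exacts [hy.1, hz.1, hxJ]
  obtain ⟨g, hg, hgeq⟩ := hlip.extend_real
  have : HasDerivAt f (g x) x := by
    rw [hasDerivAt_iff_tendsto_slope]
    refine (hg.continuous.continuousAt.tendsto.mono_left nhdsWithin_le_nhds).congr' ?_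
    have h1 : Set.Icc (x - ε) (x + ε) ∈ nhdsWithin x {x}ᶜ :=
      mem_nhdsWithin_of_mem_nhds (Icc_mem_nhds (by linarith) (by linarith))
    filter_upwards [h1, self_mem_nhdsWithin] with y hy hyx
    exact (hgeq ⟨hy, hyx⟩).symm
  exact this.differentiableAt

theorem IsToneOn.deriv {I : Set ℝ} (hI : IsOpen I) {f : ℝ → ℝ} {k : ℕ}
    (hf : IsToneOn (k + 1) I f) (hd : ∀ x ∈ I, DifferentiableAt ℝ f x) :
    IsToneOn k I (deriv f) := by
  rw [isToneOn_iff_divDiff_nonneg] at hf ⊢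
  intro s hs hsI
  have hlim : Filter.Tendsto
      (fun h : ℝ => ∑ a ∈ s, (h⁻¹ • (f (a + h) - f a)) * ∏ b ∈ s.erase a, (a - b)⁻¹)
      (nhdsWithin 0 (Set.Ioi 0)) (nhds (divDiff (_root_.deriv f) s)) := by
    refine tendsto_finsetSum _ fun a ha => Filter.Tendsto.mul_const _ ?_
    exact (hasDerivAt_iff_tendsto_slope_zero.1 (hd a (hsI ha)).hasDerivAt).mono_left
      (nhdsWithin_mono _ fun x hx => ne_of_gt hx)
  refine ge_of_tendsto hlim ?_
  have h1 : ∀ᶠ h : ℝ in nhdsWithin 0 (Set.Ioi 0), ∀ a ∈ s, a + h ∈ I := by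
    rw [Filter.eventually_all_finset]
    intro a ha
    have : Filter.Tendsto (fun h : ℝ => a + h) (nhdsWithin 0 (Set.Ioi 0)) (nhds a) := by
      have : Continuous fun h : ℝ => a + h := by fun_prop
      simpa using this.continuousAt.tendsto.mono_left (nhdsWithin_le_nhds (a := (0 : ℝ)))
    exact this (hI.mem_nhds (hsI ha))
  have h2 : ∀ᶠ h : ℝ in nhdsWithin 0 (Set.Ioi 0), ∀ a ∈ s, ∀ b ∈ s, a + h ≠ b := by
    rw [Filter.eventually_all_finset]
    intro a ha
    rw [Filter.eventually_all_finset]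
    intro b hb
    rcases le_or_gt b a with hba | hab
    · filter_upwards [self_mem_nhdsWithin] with h hh
      have : 0 < h := hh
      exact ne_of_gt (by linarith)
    · filter_upwards [Ioo_mem_nhdsGT (sub_pos.2 hab)] with h hh
      exact ne_of_lt (by linarith [hh.2])
  filter_upwards [h1, h2, self_mem_nhdsWithin] with h hhI hne hpos
  have hpos : 0 < h := hpos
  have hinj : Set.InjOn (fun a : ℝ => a + h) s := fun a _ b _ hab => add_right_cancel hab
  have := divDiff_sub_divDiff_image_le (f := f) (J := I) (M := 0) (k := k + 1)
    (by simpa using hf) s ∅ hinj (fun a _ => by simpa using hpos) hsI (by simp) hhI (by simp)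
    (by simp)
    (by
      rw [Finset.disjoint_left]
      intro b hb hb'
      obtain ⟨a, ha, hab⟩ := Finset.mem_image.1 hb'
      exact hne a ha b hb hab)
    (by simpa using hs)
  rw [Finset.union_empty, Finset.union_empty, zero_mul, divDiff_image f hinj, sub_nonpos] at this
  simp only [add_sub_add_right_eq_sub] at this
  have e : ∑ a ∈ s, (h⁻¹ • (f (a + h) - f a)) * ∏ b ∈ s.erase a, (a - b)⁻¹ =
      h⁻¹ * (∑ a ∈ s, f (a + h) * ∏ b ∈ s.erase a, (a - b)⁻¹ - divDiff f s) := by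
    rw [divDiff, ← Finset.sum_sub_distrib, Finset.mul_sum]
    refine Finset.sum_congr rfl fun a _ => ?_
    simp only [smul_eq_mul]
    ring
  rw [e]
  exact mul_nonneg (inv_nonneg.2 hpos.le) (sub_nonneg.2 this)

theorem IsToneOn.convexOn {I : Set ℝ} (hc : I.OrdConnected) {f : ℝ → ℝ}
    (hf : IsToneOn 2 I f) : ConvexOn ℝ I f := by
  refine convexOn_of_slope_mono_adjacent hc.convex fun {x y z} hx hz hxy hyz => ?_
  have h := divDiff_insert_sub_insert f (s := {y}) (by simpa using hyz.ne')
    (by simpa using hxy.ne) (hxy.trans hyz).ne'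
  have hpos : 0 ≤ divDiff f {z, x, y} := isToneOn_iff_divDiff_nonneg.1 hf _
    (Finset.card_eq_three.2 ⟨z, x, y, (hxy.trans hyz).ne', hyz.ne', hxy.ne, rfl⟩) (by
      intro w hw
      simp only [Finset.coe_insert, Finset.coe_singleton, Set.mem_insert_iff,
        Set.mem_singleton_iff] at hw
      rcases hw with rfl | rfl | rfl
      exacts [hz, hx, hc.out hx hz ⟨hxy.le, hyz.le⟩])
  have h' := mul_nonneg (sub_nonneg.2 (hxy.trans hyz).le) hpos
  rw [← h, Finset.pair_comm x y, ← slope_eq_divDiff_pair f hyz.ne,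
    ← slope_eq_divDiff_pair f hxy.ne, slope_def_field, slope_def_field] at h'
  linarith

/-- A `k`-tone function with `k ≥ 2` is of class `C^(k-2)`, and its derivative of order `k - 2` is
convex. -/
theorem IsToneOn.contDiffOn_and_convexOn {I : Set ℝ} (hI : IsOpen I) (hc : I.OrdConnected)
    {m : ℕ} {f : ℝ → ℝ} (hf : IsToneOn (m + 2) I f) :
    ContDiffOn ℝ (m : WithTop ℕ∞) f I ∧ ConvexOn ℝ I (iteratedDeriv m f) := by
  induction m generalizing f with
  | zero =>
    have h := hf.convexOn hc
    simp only [Nat.cast_zero, contDiffOn_zero, iteratedDeriv_zero]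
    exact ⟨h.continuousOn hI, h⟩
  | succ m ih =>
    have hd : ∀ x ∈ I, DifferentiableAt ℝ f x := fun x hx => hf.differentiableAt hI hc hx
    obtain ⟨h1, h2⟩ := ih (hf.deriv hI hd)
    refine ⟨?_, by rwa [iteratedDeriv_succ']⟩
    rw [Nat.cast_add, Nat.cast_one, contDiffOn_succ_iff_deriv_of_isOpen hI]
    exact ⟨fun x hx => (hd x hx).differentiableWithinAt, by simp, h1⟩

/-- The adjacency matrix of a path, with the loop weight `s` at its last vertex. -/
noncomputable def pathMatrix (m : ℕ) (s : ℝ) : Matrix (Fin (m + 1)) (Fin (m + 1)) ℂ :=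
  Matrix.of fun i j => (if i.val + 1 = j.val ∨ j.val + 1 = i.val then 1 else 0) +
    if i = Fin.last m ∧ j = Fin.last m then (s : ℂ) else 0

theorem pathMatrix_transpose (m : ℕ) (s : ℝ) : (pathMatrix m s).transpose = pathMatrix m s := by
  ext i j
  simp only [pathMatrix, Matrix.transpose_apply, Matrix.of_apply, or_comm, and_comm]

theorem pathMatrix_isHermitian (m : ℕ) (s : ℝ) : (pathMatrix m s).IsHermitian := by
  rw [Matrix.IsHermitian, Matrix.conjTranspose, pathMatrix_transpose]
  ext i j
  simp only [pathMatrix, Matrix.map_apply, Matrix.of_apply, star_add]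
  congr 1 <;> split_ifs <;> simp

theorem pathMatrix_pow_add_apply_zero (m : ℕ) (s : ℝ) (a b : ℕ) :
    (pathMatrix m s ^ (a + b)) 0 0 =
      ∑ j, (pathMatrix m s ^ a) j 0 * (pathMatrix m s ^ b) j 0 := by
  rw [pow_add, Matrix.mul_apply]
  refine Finset.sum_congr rfl fun j _ => ?_
  congr 1
  conv_lhs => rw [← pathMatrix_transpose, ← Matrix.transpose_pow, Matrix.transpose_apply]

theorem pathMatrix_pow_succ_apply (m : ℕ) (s : ℝ) (k : ℕ) (i : Fin (m + 1)) :
    (pathMatrix m s ^ (k + 1)) i 0 =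
      ∑ j, (if i.val + 1 = j.val ∨ j.val + 1 = i.val then 1 else 0) * (pathMatrix m s ^ k) j 0 +
        if i = Fin.last m then s * (pathMatrix m s ^ k) (Fin.last m) 0 else 0 := by
  rw [pow_succ', Matrix.mul_apply]
  simp only [pathMatrix, Matrix.of_apply, add_mul, Finset.sum_add_distrib]
  congr 1
  split_ifs with h <;> simp [h]

theorem pathMatrix_pow_apply (m : ℕ) (s : ℝ) (k : ℕ) (hk : k ≤ m) :
    (∀ i, (pathMatrix m s ^ k) i 0 = (pathMatrix m 0 ^ k) i 0) ∧
      (∀ i : Fin (m + 1), k < i.val → (pathMatrix m 0 ^ k) i 0 = 0) ∧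
      ∀ i : Fin (m + 1), i.val = k → (pathMatrix m 0 ^ k) i 0 = 1 := by
  induction k with
  | zero =>
    refine ⟨fun i => by simp, fun i hi => ?_, fun i hi => ?_⟩
    · rw [pow_zero, Matrix.one_apply_ne (fun h => by simp [h] at hi)]
    · rw [pow_zero, show i = 0 from Fin.ext hi, Matrix.one_apply_eq]
  | succ k ih =>
    obtain ⟨h1, h2, h3⟩ := ih (by omega)
    have hlast : (pathMatrix m 0 ^ k) (Fin.last m) 0 = 0 := h2 _ (by simp; omega)
    refine ⟨fun i => ?_, fun i hi => ?_, fun i hi => ?_⟩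
    · simp only [pathMatrix_pow_succ_apply, h1, hlast, mul_zero]
    · rw [pathMatrix_pow_succ_apply, hlast, mul_zero, ite_self, add_zero]
      refine Finset.sum_eq_zero fun j _ => ?_
      split_ifs with hij
      · rw [h2 j (by omega), mul_zero]
      · rw [zero_mul]
    · rw [pathMatrix_pow_succ_apply, hlast, mul_zero, ite_self, add_zero,
        Finset.sum_eq_single (⟨k, by omega⟩ : Fin (m + 1))]
      · rw [h3 _ rfl, if_pos (Or.inr (by simp [hi])), one_mul]
      · intro j _ hj
        have hj' : j.val ≠ k := fun h => hj (Fin.ext h)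
        split_ifs with hij
        · rw [h2 j (by omega), mul_zero]
        · rw [zero_mul]
      · simp

theorem pathMatrix_pow_zero_zero_of_le (m : ℕ) (s : ℝ) {k : ℕ} (hk : k ≤ 2 * m) :
    (pathMatrix m s ^ k) 0 0 = (pathMatrix m 0 ^ k) 0 0 := by
  obtain ⟨a, b, ha, hb, rfl⟩ : ∃ a b, a ≤ m ∧ b ≤ m ∧ k = a + b :=
    ⟨k / 2, k - k / 2, by omega, by omega, by omega⟩
  simp only [pathMatrix_pow_add_apply_zero, (pathMatrix_pow_apply m s a ha).1,
    (pathMatrix_pow_apply m s b hb).1]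

theorem pathMatrix_pow_half (m : ℕ) : ∃ v : Fin (m + 1) → ℂ, ∀ (s : ℝ) (i : Fin (m + 1)),
    (pathMatrix m s ^ (m + 1)) i 0 = v i + if i = Fin.last m then (s : ℂ) else 0 := by
  refine ⟨fun i => ∑ j, (if i.val + 1 = j.val ∨ j.val + 1 = i.val then 1 else 0) *
    (pathMatrix m 0 ^ m) j 0, fun s i => ?_⟩
  simp only [pathMatrix_pow_succ_apply, (pathMatrix_pow_apply m s m le_rfl).1,
    (pathMatrix_pow_apply m s m le_rfl).2.2 (Fin.last m) rfl, mul_one]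

theorem pathMatrix_pow_odd (m : ℕ) :
    ∃ c : ℂ, ∀ s : ℝ, (pathMatrix m s ^ (2 * m + 1)) 0 0 = c + s := by
  obtain ⟨v, hv⟩ := pathMatrix_pow_half m
  refine ⟨∑ j, (pathMatrix m 0 ^ m) j 0 * v j, fun s => ?_⟩
  rw [show 2 * m + 1 = m + (m + 1) by ring, pathMatrix_pow_add_apply_zero]
  simp [(pathMatrix_pow_apply m s m le_rfl).1, hv, mul_add, Finset.sum_add_distrib,
    (pathMatrix_pow_apply m s m le_rfl).2.2 (Fin.last m) rfl]

theorem pathMatrix_pow_even (m : ℕ) :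
    ∃ c d : ℂ, ∀ s : ℝ, (pathMatrix m s ^ (2 * m + 2)) 0 0 = c + d * s + s ^ 2 := by
  obtain ⟨v, hv⟩ := pathMatrix_pow_half m
  refine ⟨∑ j, v j * v j, 2 * v (Fin.last m), fun s => ?_⟩
  rw [show 2 * m + 2 = (m + 1) + (m + 1) by ring, pathMatrix_pow_add_apply_zero]
  simp [hv, mul_add, add_mul, Finset.sum_add_distrib]
  ring

theorem Matrix.IsHermitian.exists_cfc_apply_eq {n : Type*} [Fintype n] [DecidableEq n]
    {A : Matrix n n ℂ} (hA : A.IsHermitian) (i : n) :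
    ∃ w : n → ℝ, ∀ f : ℝ → ℝ, cfc f A i i = ((∑ j, w j * f (hA.eigenvalues j) : ℝ) : ℂ) := by
  refine ⟨fun j => Complex.normSq ((hA.eigenvectorUnitary : Matrix n n ℂ) i j), fun f => ?_⟩
  rw [hA.cfc_eq, Matrix.IsHermitian.cfc, Unitary.conjStarAlgAut_apply, Matrix.mul_apply]
  push_cast
  refine Finset.sum_congr rfl fun j _ => ?_
  rw [Matrix.mul_diagonal, Matrix.star_apply, Complex.normSq_eq_conj_mul_self]
  simp only [Function.comp_apply, Complex.star_def, Complex.coe_algebraMap]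
  ring!

/-- The affine image `x + ε M_s` of the path matrix. -/
noncomputable def affinePathMatrix (m : ℕ) (x ε s : ℝ) : Matrix (Fin (m + 1)) (Fin (m + 1)) ℂ :=
  x • 1 + ε • pathMatrix m s

theorem affinePathMatrix_eq_cfc (m : ℕ) (x ε s : ℝ) :
    affinePathMatrix m x ε s = cfc (fun y => x + ε * y) (pathMatrix m s) := by
  have h : IsSelfAdjoint (pathMatrix m s) := pathMatrix_isHermitian m s
  rw [cfc_const_add x (fun y => ε * y) _ (by fun_prop) h, cfc_const_mul_id ε _ h,
    affinePathMatrix, Algebra.algebraMap_eq_smul_one]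

theorem affinePathMatrix_isHermitian (m : ℕ) (x ε s : ℝ) :
    (affinePathMatrix m x ε s).IsHermitian := by
  rw [affinePathMatrix_eq_cfc]
  exact cfc_predicate _ _

theorem cfc_affinePathMatrix (m : ℕ) (x ε s : ℝ) (f : ℝ → ℝ) :
    cfc f (affinePathMatrix m x ε s) = cfc (fun y => f (x + ε * y)) (pathMatrix m s) := by
  have h : IsSelfAdjoint (pathMatrix m s) := pathMatrix_isHermitian m s
  rw [affinePathMatrix_eq_cfc, cfc_comp' f (fun y => x + ε * y) _
    (Set.Finite.continuousOn ((Matrix.finite_real_spectrum).image _) _)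
    (by fun_prop) h]

theorem spectrum_affinePathMatrix (m : ℕ) (x ε s : ℝ) {I : Set ℝ}
    (hI : ∀ i, x + ε * (pathMatrix_isHermitian m s).eigenvalues i ∈ I) :
    spectrum ℝ (affinePathMatrix m x ε s) ⊆ I := by
  have h : IsSelfAdjoint (pathMatrix m s) := pathMatrix_isHermitian m s
  rw [affinePathMatrix_eq_cfc, cfc_map_spectrum (fun y => x + ε * y) _ h (by fun_prop),
    (pathMatrix_isHermitian m s).spectrum_real_eq_range_eigenvalues]
  rintro _ ⟨_, ⟨i, rfl⟩, rfl⟩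
  exact hI i

theorem affinePathMatrix_mono (m : ℕ) (x : ℝ) {ε s t : ℝ} (hε : 0 ≤ ε) (hst : s ≤ t) :
    affinePathMatrix m x ε s ≤ affinePathMatrix m x ε t := by
  rw [Matrix.le_iff]
  have : affinePathMatrix m x ε t - affinePathMatrix m x ε s =
      Matrix.diagonal fun i => if i = Fin.last m then ((ε * (t - s) : ℝ) : ℂ) else 0 := by
    ext i j
    rw [affinePathMatrix, affinePathMatrix, add_sub_add_left_eq_sub, ← smul_sub,
      Matrix.smul_apply, Matrix.sub_apply, pathMatrix, pathMatrix, Matrix.of_apply,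
      Matrix.of_apply, add_sub_add_left_eq_sub, Matrix.diagonal_apply]
    by_cases hi : i = Fin.last m <;> by_cases hj : j = Fin.last m <;>
      by_cases hij : i = j <;> simp_all
  rw [this]
  refine Matrix.PosSemidef.diagonal fun i => ?_
  dsimp only
  split_ifs
  · rw [Pi.zero_apply]
    exact_mod_cast mul_nonneg hε (sub_nonneg.2 hst)
  · exact le_rfl

theorem affinePathMatrix_midpoint (m : ℕ) (x ε : ℝ) :
    (1 / 2 : ℝ) • affinePathMatrix m x ε 1 + (1 - 1 / 2 : ℝ) • affinePathMatrix m x ε (-1) =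
      affinePathMatrix m x ε 0 := by
  ext i j
  simp only [affinePathMatrix, pathMatrix, Matrix.add_apply, Matrix.smul_apply, Matrix.of_apply,
    Complex.real_smul]
  split_ifs <;> push_cast <;> ring

theorem Matrix.re_apply_self_mono {n : Type*} [Fintype n] [DecidableEq n] {A B : Matrix n n ℂ}
    (h : A ≤ B) (i : n) : (A i i).re ≤ (B i i).re := by
  have := (Matrix.le_iff.1 h).diag_nonneg (i := i)
  rw [Matrix.sub_apply, sub_nonneg] at this
  exact (Complex.le_def.1 this).1

/-- `f` satisfies the inequalities `0 ≤ ∑ i, c i * f (x + ε * y i)`, for a finite functional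
`(c, y)` which annihilates polynomials of degree less than `d` and is positive on `X ^ d`. -/
def HasPositiveDifferences (d : ℕ) (I : Set ℝ) (f : ℝ → ℝ) : Prop :=
  ∃ (ι : Type) (_ : Fintype ι) (c y : ι → ℝ), (∀ k < d, ∑ i, c i * y i ^ k = 0) ∧
    0 < ∑ i, c i * y i ^ d ∧
    ∀ x ε : ℝ, 0 < ε → (∀ i, x + ε * y i ∈ I) → 0 ≤ ∑ i, c i * f (x + ε * y i)

theorem exists_pathMatrix_weights (m : ℕ) (s : ℝ) : ∃ w : Fin (m + 1) → ℝ,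
    (∀ f : ℝ → ℝ, (cfc f (pathMatrix m s) 0 0).re =
      ∑ j, w j * f ((pathMatrix_isHermitian m s).eigenvalues j)) ∧
    ∀ k : ℕ, ((pathMatrix m s ^ k) 0 0).re =
      ∑ j, w j * (pathMatrix_isHermitian m s).eigenvalues j ^ k := by
  obtain ⟨w, hw⟩ := (pathMatrix_isHermitian m s).exists_cfc_apply_eq 0
  refine ⟨w, fun f => by rw [hw, Complex.ofReal_re], fun k => ?_⟩
  have h : IsSelfAdjoint (pathMatrix m s) := pathMatrix_isHermitian m s
  rw [← cfc_pow_id (R := ℝ) (pathMatrix m s) k h, hw, Complex.ofReal_re]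

theorem IsMatrixMonotoneOn.hasPositiveDifferences {m : ℕ} {I : Set ℝ} {f : ℝ → ℝ}
    (hf : IsMatrixMonotoneOn (m + 1) I f) : HasPositiveDifferences (2 * m + 1) I f := by
  obtain ⟨w₀, h₀, p₀⟩ := exists_pathMatrix_weights m 0
  obtain ⟨w₁, h₁, p₁⟩ := exists_pathMatrix_weights m 1
  refine ⟨Fin (m + 1) ⊕ Fin (m + 1), inferInstance, Sum.elim w₁ (-w₀),
    Sum.elim (pathMatrix_isHermitian m 1).eigenvalues (pathMatrix_isHermitian m 0).eigenvalues,
    fun k hk => ?_, ?_, fun x ε hε hI => ?_⟩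
  · simp only [Fintype.sum_sum_type, Sum.elim_inl, Sum.elim_inr, Pi.neg_apply, neg_mul,
      Finset.sum_neg_distrib, ← p₀, ← p₁]
    rw [pathMatrix_pow_zero_zero_of_le m 1 (by omega), add_neg_cancel]
  · simp only [Fintype.sum_sum_type, Sum.elim_inl, Sum.elim_inr, Pi.neg_apply, neg_mul,
      Finset.sum_neg_distrib, ← p₀, ← p₁]
    obtain ⟨c, hc⟩ := pathMatrix_pow_odd m
    simp [hc]
  · simp only [Sum.forall, Sum.elim_inl, Sum.elim_inr] at hI
    have := Matrix.re_apply_self_mono (hf _ _ (affinePathMatrix_isHermitian m x ε 0)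
      (affinePathMatrix_isHermitian m x ε 1) (spectrum_affinePathMatrix m x ε 0 hI.2)
      (spectrum_affinePathMatrix m x ε 1 hI.1) (affinePathMatrix_mono m x hε.le zero_le_one)) 0
    rw [cfc_affinePathMatrix, cfc_affinePathMatrix, h₀, h₁] at this
    simp only [Fintype.sum_sum_type, Sum.elim_inl, Sum.elim_inr, Pi.neg_apply, neg_mul,
      Finset.sum_neg_distrib]
    linarith

theorem IsMatrixConvexOn.hasPositiveDifferences {m : ℕ} {I : Set ℝ} {f : ℝ → ℝ}
    (hf : IsMatrixConvexOn (m + 1) I f) : HasPositiveDifferences (2 * m + 2) I f := by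
  obtain ⟨w₀, h₀, p₀⟩ := exists_pathMatrix_weights m 0
  obtain ⟨w₁, h₁, p₁⟩ := exists_pathMatrix_weights m 1
  obtain ⟨w₂, h₂, p₂⟩ := exists_pathMatrix_weights m (-1)
  let c := Sum.elim ((1 / 2 : ℝ) • w₁) (Sum.elim ((1 / 2 : ℝ) • w₂) (-w₀))
  let y := Sum.elim (pathMatrix_isHermitian m 1).eigenvalues
    (Sum.elim (pathMatrix_isHermitian m (-1)).eigenvalues (pathMatrix_isHermitian m 0).eigenvalues)
  have key : ∀ k, ∑ i, c i * y i ^ k =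
      1 / 2 * ((pathMatrix m 1 ^ k) 0 0).re + (1 / 2 * ((pathMatrix m (-1) ^ k) 0 0).re -
        ((pathMatrix m 0 ^ k) 0 0).re) := by
    intro k
    simp only [c, y, Fintype.sum_sum_type, Sum.elim_inl, Sum.elim_inr, Pi.neg_apply, neg_mul,
      Finset.sum_neg_distrib, p₀, p₁, p₂, Pi.smul_apply, smul_eq_mul, mul_assoc, ← Finset.mul_sum]
    ring
  refine ⟨Fin (m + 1) ⊕ Fin (m + 1) ⊕ Fin (m + 1), inferInstance, c, y, fun k hk => ?_, ?_,
    fun x ε hε hI => ?_⟩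
  · rw [key]
    rcases eq_or_ne k (2 * m + 1) with rfl | hne
    · obtain ⟨c, hc⟩ := pathMatrix_pow_odd m
      simp only [hc, Complex.add_re, Complex.ofReal_re]
      ring
    · rw [pathMatrix_pow_zero_zero_of_le m 1 (by omega),
        pathMatrix_pow_zero_zero_of_le m (-1) (by omega)]
      ring
  · rw [key]
    obtain ⟨c, d, hc⟩ := pathMatrix_pow_even m
    simp only [hc, Complex.add_re, ← Complex.ofReal_pow, Complex.ofReal_re, Complex.re_mul_ofReal]
    ring_nf
    norm_num
  · simp only [y, Sum.forall, Sum.elim_inl, Sum.elim_inr] at hI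
    have := Matrix.re_apply_self_mono (hf _ _ (affinePathMatrix_isHermitian m x ε 1)
      (affinePathMatrix_isHermitian m x ε (-1)) (spectrum_affinePathMatrix m x ε 1 hI.1)
      (spectrum_affinePathMatrix m x ε (-1) hI.2.1) (1 / 2) (by norm_num) (by norm_num)) 0
    rw [affinePathMatrix_midpoint, Matrix.add_apply, Matrix.smul_apply, Matrix.smul_apply,
      cfc_affinePathMatrix, cfc_affinePathMatrix, cfc_affinePathMatrix, Complex.add_re,
      Complex.smul_re, Complex.smul_re, h₀, h₁, h₂] at this
    simp only [c, y, Fintype.sum_sum_type, Sum.elim_inl, Sum.elim_inr, Pi.neg_apply, neg_mul,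
      Finset.sum_neg_distrib, Pi.smul_apply, smul_eq_mul, mul_assoc, ← Finset.mul_sum]
    simp only [smul_eq_mul] at this
    linarith

/-- A smooth function with non-negative derivative of order `m` is `m`-tone. -/
theorem isToneOn_of_iteratedDeriv_nonneg {J : Set ℝ} (hJ : J.OrdConnected) (m : ℕ) {g : ℝ → ℝ}
    (hg : ContDiff ℝ (⊤ : ℕ∞) g) (hpos : ∀ x ∈ J, 0 ≤ iteratedDeriv m g x) :
    IsToneOn m J g := by
  induction m generalizing g with
  | zero =>
    rw [isToneOn_iff_divDiff_nonneg]
    intro s hs hsJ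
    obtain ⟨a, rfl⟩ := Finset.card_eq_one.1 hs
    rw [divDiff_singleton]
    simpa using hpos a (hsJ (by simp))
  | succ m ih =>
    have hg' := contDiff_infty_iff_deriv.1 hg
    have hih := isToneOn_iff_divDiff_nonneg.1
      (ih hg'.2 fun x hx => by rw [← iteratedDeriv_succ']; exact hpos x hx)
    rw [isToneOn_iff_divDiff_nonneg]
    intro s hs hsJ
    obtain ⟨x₀, hx₀⟩ : s.Nonempty := Finset.card_pos.1 (by omega)
    set w : ℝ → ℝ := fun a => ∏ b ∈ s.erase a, (a - b)⁻¹ with hw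
    let ψ : ℝ → ℝ := fun t => ∑ a ∈ s, g (x₀ + t * (a - x₀)) * w a
    have hψ : ∀ t, HasDerivAt ψ (∑ a ∈ s, deriv g (x₀ + t * (a - x₀)) * (a - x₀) * w a) t := by
      intro t
      refine HasDerivAt.fun_sum fun a _ => HasDerivAt.mul_const ?_ _
      refine HasDerivAt.comp (h₂ := g) t (hg'.1 _).hasDerivAt ?_
      simpa using ((hasDerivAt_id t).mul_const (a - x₀)).const_add x₀
    have hmono : MonotoneOn ψ (Set.Icc 0 1) := by
      refine monotoneOn_of_deriv_nonneg (convex_Icc 0 1)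
        (fun t _ => (hψ t).continuousAt.continuousWithinAt)
        (fun t _ => (hψ t).differentiableAt.differentiableWithinAt) fun t ht => ?_
      rw [interior_Icc] at ht
      rw [(hψ t).deriv, ← Finset.add_sum_erase s _ hx₀, sub_self, mul_zero, zero_mul, zero_add]
      have hcard : (s.erase x₀).card = m + 1 := by rw [Finset.card_erase_of_mem hx₀]; omega
      have hinj : Set.InjOn (fun a => x₀ + t * (a - x₀)) (s.erase x₀) := by
        intro a _ b _ hab
        have := mul_left_cancel₀ ht.1.ne' (add_left_cancel hab)
        linarith
      have h := hih ((s.erase x₀).image fun a => x₀ + t * (a - x₀))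
        (by rw [Finset.card_image_of_injOn hinj, hcard]) (by
          intro y hy
          obtain ⟨a, ha, rfl⟩ := Finset.mem_image.1 (Finset.mem_coe.1 hy)
          have := hJ.convex (hsJ hx₀) (hsJ (Finset.mem_of_mem_erase ha))
            (sub_nonneg.2 ht.2.le) ht.1.le (by ring)
          simp only [smul_eq_mul] at this
          convert this using 1
          ring)
      rw [divDiff_image _ hinj] at h
      have h' := mul_nonneg (pow_nonneg ht.1.le m) h
      rw [Finset.mul_sum] at h'
      refine h'.trans_eq (Finset.sum_congr rfl fun a ha => ?_)
      have hax : a - x₀ ≠ 0 := sub_ne_zero.2 (Finset.ne_of_mem_erase ha)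
      have e1 : (a - x₀) * w a = ∏ b ∈ (s.erase x₀).erase a, (a - b)⁻¹ := by
        have hmem : x₀ ∈ s.erase a :=
          Finset.mem_erase.2 ⟨(Finset.ne_of_mem_erase ha).symm, hx₀⟩
        simp only [hw]
        rw [← Finset.mul_prod_erase _ _ hmem, mul_inv_cancel_left₀ hax,
          Finset.erase_right_comm]
      have e2 : ∏ b ∈ (s.erase x₀).erase a, (x₀ + t * (a - x₀) - (x₀ + t * (b - x₀)))⁻¹ =
          (t ^ m)⁻¹ * ∏ b ∈ (s.erase x₀).erase a, (a - b)⁻¹ := by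
        have : ∀ b, (x₀ + t * (a - x₀) - (x₀ + t * (b - x₀)))⁻¹ = t⁻¹ * (a - b)⁻¹ := fun b => by
          rw [← mul_inv]; congr 1; ring
        simp only [this, Finset.prod_mul_distrib, Finset.prod_const]
        rw [Finset.card_erase_of_mem ha, hcard, Nat.add_sub_cancel, inv_pow]
      rw [e2, mul_assoc, e1]
      have : t ^ m ≠ 0 := (pow_pos ht.1 m).ne'
      field_simp
    have h0 : ψ 0 = 0 := by
      have := divDiff_one (s := s) (by omega)
      simp only [divDiff, one_mul] at this
      simp only [ψ, zero_mul, add_zero, ← Finset.mul_sum, hw, this, mul_zero]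
    have h1 : ψ 1 = divDiff g s := by
      simp only [ψ, one_mul, add_sub_cancel, divDiff, hw]
    rw [← h1, ← h0]
    exact hmono (by simp) (by simp) zero_le_one

theorem iteratedDeriv_nonneg_of_differences_nonneg {ι : Type*} [Fintype ι] {c y : ι → ℝ} {d : ℕ}
    (h0 : ∀ k < d, ∑ i, c i * y i ^ k = 0) (hd : 0 < ∑ i, c i * y i ^ d) {g : ℝ → ℝ}
    (hg : ContDiff ℝ (⊤ : ℕ∞) g) {x : ℝ}
    (h : ∀ᶠ ε in nhdsWithin 0 (Set.Ioi 0), 0 ≤ ∑ i, c i * g (x + ε * y i)) :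
    0 ≤ iteratedDeriv d g x := by
  have hgn : ∀ n : ℕ, ContDiff ℝ n g := fun n => hg.of_le (by exact_mod_cast le_top)
  have hcomp : ∀ (n : ℕ) (i : ι), ContDiff ℝ n fun ε => g (x + y i * ε) := fun n i =>
    (hgn n).comp (by fun_prop)
  let ψ : ℝ → ℝ := fun ε => ∑ i, c i * g (x + y i * ε)
  have hψ : ∀ n : ℕ, ContDiff ℝ n ψ := fun n =>
    ContDiff.sum fun i _ => contDiff_const.mul (hcomp n i)
  have hder : ∀ n : ℕ, iteratedDeriv n ψ 0 = (∑ i, c i * y i ^ n) * iteratedDeriv n g x := by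
    intro n
    rw [iteratedDeriv_fun_sum fun i _ => (contDiff_const.mul (hcomp n i)).contDiffAt,
      Finset.sum_mul]
    refine Finset.sum_congr rfl fun i _ => ?_
    have hs : ContDiff ℝ n fun z => g (x + z) := (hgn n).comp (by fun_prop)
    rw [iteratedDeriv_const_mul_field, iteratedDeriv_comp_const_mul hs (y i),
      iteratedDeriv_comp_const_add]
    simp [mul_assoc]
  have ht := taylor_isLittleO_univ (x₀ := 0) (hψ d)
  have hT : ∀ ε, taylorWithinEval ψ d Set.univ 0 ε =
      ε ^ d * ((d.factorial : ℝ)⁻¹ * iteratedDeriv d ψ 0) := by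
    intro ε
    rw [taylor_within_apply, Finset.sum_range_succ, Finset.sum_eq_zero, zero_add]
    · rw [iteratedDerivWithin_univ, sub_zero, smul_eq_mul]
      ring
    · intro k hk
      rw [iteratedDerivWithin_univ, hder, h0 k (Finset.mem_range.1 hk), zero_mul, smul_zero]
  have hlim : Filter.Tendsto (fun ε => ψ ε / ε ^ d) (nhdsWithin 0 (Set.Ioi 0))
      (nhds ((d.factorial : ℝ)⁻¹ * iteratedDeriv d ψ 0)) := by
    have := (ht.mono (nhdsWithin_le_nhds (s := Set.Ioi 0))).tendsto_div_nhds_zero.add_const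
      ((d.factorial : ℝ)⁻¹ * iteratedDeriv d ψ 0)
    rw [zero_add] at this
    refine this.congr' ?_
    filter_upwards [self_mem_nhdsWithin] with ε hε
    have : ε ^ d ≠ 0 := (pow_pos hε d).ne'
    rw [hT, sub_zero]
    field_simp
    ring
  have hnn : 0 ≤ (d.factorial : ℝ)⁻¹ * iteratedDeriv d ψ 0 := by
    refine ge_of_tendsto hlim ?_
    filter_upwards [h, self_mem_nhdsWithin] with ε hε hpos
    refine div_nonneg ?_ (pow_pos hpos d).le
    simpa only [ψ, mul_comm ε] using hε
  rw [hder] at hnn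
  have := nonneg_of_mul_nonneg_right hnn (by positivity)
  exact nonneg_of_mul_nonneg_right this hd

theorem tendsto_divDiff {α : Type*} {l : Filter α} {G : α → ℝ → ℝ} {f : ℝ → ℝ} {s : Finset ℝ}
    (h : ∀ a ∈ s, Filter.Tendsto (fun j => G j a) l (nhds (f a))) :
    Filter.Tendsto (fun j => divDiff (G j) s) l (nhds (divDiff f s)) :=
  tendsto_finsetSum _ fun a ha => (h a ha).mul_const _

/-- By mollification, the divided differences of order `d` are non-negative over nodes in a
conull set. -/
theorem HasPositiveDifferences.exists_ae_divDiff_nonneg {d : ℕ} {I : Set ℝ} {f : ℝ → ℝ}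
    (hf : HasPositiveDifferences d I f) {a' a b b' : ℝ} (ha : a' < a) (hb : b < b')
    (hI : Set.Icc a' b' ⊆ I) (hint : IntegrableOn f (Set.Icc a' b')) :
    ∃ S : Set ℝ, (∀ᵐ x, x ∈ S) ∧
      ∀ s : Finset ℝ, s.card = d + 1 → ↑s ⊆ S → ↑s ⊆ Set.Ioo a b → 0 ≤ divDiff f s := by
  obtain ⟨ι, _, c, y, h0, hd, hpos⟩ := hf
  set F : ℝ → ℝ := (Set.Icc a' b').indicator f with hF
  have hFint : LocallyIntegrable F volume :=
    (hint.integrable_indicator measurableSet_Icc).locallyIntegrable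
  have hr : ∀ j : ℕ, (0 : ℝ) < 1 / ((j : ℝ) + 1) := fun j => by positivity
  let φ : ℕ → ContDiffBump (0 : ℝ) := fun j =>
    ⟨1 / ((j : ℝ) + 1), 2 * (1 / ((j : ℝ) + 1)), hr j, by linarith [hr j]⟩
  have hφ0 : Filter.Tendsto (fun j => (φ j).rOut) Filter.atTop (nhds 0) := by
    have := (tendsto_one_div_add_atTop_nhds_zero_nat (𝕜 := ℝ)).const_mul 2
    rwa [mul_zero] at this
  let G : ℕ → ℝ → ℝ := fun j =>
    convolution ((φ j).normed volume) F (ContinuousLinearMap.lsmul ℝ ℝ) volume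
  have hG : ∀ j, ContDiff ℝ (⊤ : ℕ∞) (G j) := fun j =>
    (φ j).hasCompactSupport_normed.contDiff_convolution_left _ (φ j).contDiff_normed hFint
  have hae : ∀ᵐ x, Filter.Tendsto (fun j => G j x) Filter.atTop (nhds (F x)) :=
    ContDiffBump.ae_convolution_tendsto_right_of_locallyIntegrable (K := 2) hφ0
      (Filter.Eventually.of_forall fun j => le_rfl) hFint
  refine ⟨{x | Filter.Tendsto (fun j => G j x) Filter.atTop (nhds (F x))}, hae,
    fun s hs hsS hsab => ?_⟩
  have hsub : Set.Ioo a b ⊆ Set.Icc a' b' := fun x hx => ⟨(ha.trans hx.1).le, (hx.2.trans hb).le⟩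
  have hFf : ∀ x ∈ Set.Icc a' b', F x = f x := fun x hx => Set.indicator_of_mem hx f
  have hdF : divDiff F s = divDiff f s :=
    Finset.sum_congr rfl fun x hx => by rw [hFf x (hsub (hsab hx))]
  rw [← hdF]
  refine ge_of_tendsto (tendsto_divDiff fun x hx => hsS hx) ?_
  have hδ : 0 < min (a - a') (b' - b) := lt_min (by linarith) (by linarith)
  filter_upwards [hφ0.eventually_lt_const hδ] with j hj
  have hj1 := hj.trans_le (min_le_left _ _)
  have hj2 := hj.trans_le (min_le_right _ _)
  refine isToneOn_iff_divDiff_nonneg.1 (isToneOn_of_iteratedDeriv_nonneg Set.ordConnected_Ioo d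
    (hG j) fun x hx => ?_) s hs hsab
  refine iteratedDeriv_nonneg_of_differences_nonneg h0 hd (hG j) ?_
  have hev : ∀ᶠ ε in nhdsWithin (0 : ℝ) (Set.Ioi 0), ∀ i, x + ε * y i ∈ Set.Ioo a b := by
    rw [Filter.eventually_all]
    intro i
    have hc : Continuous fun ε : ℝ => x + ε * y i := by fun_prop
    have ht : Filter.Tendsto (fun ε : ℝ => x + ε * y i) (nhdsWithin (0 : ℝ) (Set.Ioi 0))
        (nhds x) := by
      simpa using hc.continuousAt.tendsto.mono_left (nhdsWithin_le_nhds (a := (0 : ℝ)))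
    exact ht (isOpen_Ioo.mem_nhds hx)
  filter_upwards [hev, self_mem_nhdsWithin] with ε hε hεpos
  have hconv : ∀ z, Integrable fun t => (φ j).normed volume t * F (z - t) := fun z =>
    (φ j).hasCompactSupport_normed.convolutionExists_left (ContinuousLinearMap.lsmul ℝ ℝ)
      (φ j).continuous_normed hFint z
  have hGz : ∀ z, G j z = ∫ t, (φ j).normed volume t * F (z - t) := fun z => rfl
  simp only [hGz, ← integral_const_mul]
  rw [← integral_finsetSum _ fun i _ => (hconv _).const_mul _]
  refine integral_nonneg fun t => ?_
  have e : ∑ i, c i * ((φ j).normed volume t * F (x + ε * y i - t)) =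
      (φ j).normed volume t * ∑ i, c i * F (x + ε * y i - t) := by
    rw [Finset.mul_sum]
    exact Finset.sum_congr rfl fun i _ => by ring
  simp only [Pi.zero_apply, e]
  by_cases ht : (φ j).normed volume t = 0
  · rw [ht, zero_mul]
  have ht' : t ∈ Metric.ball (0 : ℝ) (φ j).rOut := by
    rw [← (φ j).support_normed_eq (μ := volume)]
    exact ht
  rw [mem_ball_zero_iff, Real.norm_eq_abs, abs_lt] at ht'
  refine mul_nonneg ((φ j).nonneg_normed t) ?_
  have hmem : ∀ i, x + ε * y i - t ∈ Set.Icc a' b' := fun i =>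
    ⟨by linarith [(hε i).1], by linarith [(hε i).2]⟩
  have := hpos (x - t) ε hεpos fun i => hI (by convert hmem i using 1; ring)
  refine this.trans_eq (Finset.sum_congr rfl fun i _ => ?_)
  rw [hFf _ (hmem i)]
  congr 2
  ring

theorem nhdsWithin_inter_neBot_of_dense {S U : Set ℝ} (hS : Dense S) (hU : IsOpen U) {x : ℝ}
    (hx : x ∈ closure U) : (nhdsWithin x (U ∩ S)).NeBot :=
  mem_closure_iff_nhdsWithin_neBot.1
    (closure_minimal (hS.open_subset_closure_inter hU) isClosed_closure hx)

/-- A function with positive differences of order `d` is `d`-tone, provided that it is locally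
integrable and that its values can be compared with its one-sided limits. -/
theorem HasPositiveDifferences.isToneOn {d : ℕ} {I : Set ℝ} (hIo : IsOpen I)
    (hIc : I.OrdConnected) {f : ℝ → ℝ} (hf : HasPositiveDifferences d I f)
    (hint : ∀ a b, Set.Icc a b ⊆ I → IntegrableOn f (Set.Icc a b))
    (hlim : ∀ x ∈ I, ∀ c : ℝ, ∃ L, c * L ≤ c * f x ∧
      (Filter.Tendsto f (nhdsWithin x (Set.Iio x)) (nhds L) ∨
        Filter.Tendsto f (nhdsWithin x (Set.Ioi x)) (nhds L))) :
    IsToneOn d I f := by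
  rw [isToneOn_iff_divDiff_nonneg]
  intro s hs hsI
  have hne : s.Nonempty := Finset.card_pos.1 (by omega)
  obtain ⟨a, b, ha, hb, hab⟩ := exists_Icc_superset hIo hIc (s.min'_le_max' hne)
    (hIc.out (hsI (s.min'_mem hne)) (hsI (s.max'_mem hne)))
  obtain ⟨a', b', ha', hb', hab'⟩ := exists_Icc_superset hIo hIc
    (ha.le.trans ((s.min'_le_max' hne).trans hb.le)) hab
  obtain ⟨S, hS, hpos⟩ := hf.exists_ae_divDiff_nonneg ha' hb' hab' (hint _ _ hab')
  have hdense : Dense S := Measure.dense_of_ae hS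
  have hex : ∀ x : ℝ, ∃ (U : Set ℝ) (L : ℝ), (nhdsWithin x U).NeBot ∧ (x ∈ s → U ⊆ S ∧
      Filter.Tendsto f (nhdsWithin x U) (nhds L) ∧
      (∏ z ∈ s.erase x, (x - z)⁻¹) * L ≤ (∏ z ∈ s.erase x, (x - z)⁻¹) * f x) := by
    intro x
    by_cases hx : x ∈ s
    · obtain ⟨L, hL, h | h⟩ := hlim x (hsI hx) (∏ z ∈ s.erase x, (x - z)⁻¹)
      · refine ⟨Set.Iio x ∩ S, L, nhdsWithin_inter_neBot_of_dense hdense isOpen_Iio (by simp),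
          fun _ => ⟨Set.inter_subset_right, h.mono_left (nhdsWithin_mono _ Set.inter_subset_left),
            hL⟩⟩
      · refine ⟨Set.Ioi x ∩ S, L, nhdsWithin_inter_neBot_of_dense hdense isOpen_Ioi (by simp),
          fun _ => ⟨Set.inter_subset_right, h.mono_left (nhdsWithin_mono _ Set.inter_subset_left),
            hL⟩⟩
    · exact ⟨Set.univ, 0, by rw [nhdsWithin_univ]; infer_instance, fun h => (hx h).elim⟩
  choose U L hU hUL using hex
  let P : Filter (ℝ → ℝ) := Filter.pi fun x => nhdsWithin x (U x)
  have hPU : ∀ x, Filter.Tendsto (fun u : ℝ → ℝ => u x) P (nhdsWithin x (U x)) := fun x =>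
    Filter.tendsto_eval_pi _ x
  have hP : ∀ x, Filter.Tendsto (fun u : ℝ → ℝ => u x) P (nhds x) := fun x =>
    (hPU x).mono_right nhdsWithin_le_nhds
  have hlimit : Filter.Tendsto
      (fun u : ℝ → ℝ => ∑ x ∈ s, f (u x) * ∏ z ∈ s.erase x, (u x - u z)⁻¹) P
      (nhds (∑ x ∈ s, L x * ∏ z ∈ s.erase x, (x - z)⁻¹)) := by
    refine tendsto_finsetSum _ fun x hx => ((hUL x hx).2.1.comp (hPU x)).mul ?_
    refine tendsto_finsetProd _ fun z hz => ((hP x).sub (hP z)).inv₀ ?_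
    exact sub_ne_zero.2 (Finset.ne_of_mem_erase hz).symm
  have hle : ∑ x ∈ s, L x * ∏ z ∈ s.erase x, (x - z)⁻¹ ≤ divDiff f s := by
    refine Finset.sum_le_sum fun x hx => ?_
    rw [mul_comm (L x), mul_comm (f x)]
    exact (hUL x hx).2.2
  refine (ge_of_tendsto hlimit ?_).trans hle
  have h1 : ∀ᶠ u in P, ∀ x ∈ s, u x ∈ S ∧ u x ∈ Set.Ioo a b := by
    rw [Filter.eventually_all_finset]
    intro x hx
    refine ((hPU x).eventually (Filter.mem_of_superset self_mem_nhdsWithin (hUL x hx).1)).and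
      ((hP x).eventually (isOpen_Ioo.mem_nhds ⟨?_, ?_⟩))
    · exact ha.trans_le (s.min'_le x hx)
    · exact (s.le_max' x hx).trans_lt hb
  have h2 : ∀ᶠ u in P, ∀ x ∈ s, ∀ z ∈ s, x ≠ z → u x ≠ u z := by
    rw [Filter.eventually_all_finset]
    intro x hx
    rw [Filter.eventually_all_finset]
    intro z hz
    by_cases hxz : x = z
    · simp [hxz]
    · filter_upwards [((hP x).sub (hP z)).eventually_ne (sub_ne_zero.2 hxz)] with u hu _
      exact sub_ne_zero.1 hu
  filter_upwards [h1, h2] with u hu1 hu2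
  have hinj : Set.InjOn u s := fun x hx z hz h => by
    by_contra hxz
    exact hu2 x hx z hz hxz h
  rw [← divDiff_image f hinj]
  refine hpos _ (by rw [Finset.card_image_of_injOn hinj, hs]) ?_ ?_
  · intro z hz
    obtain ⟨x, hx, rfl⟩ := Finset.mem_image.1 (Finset.mem_coe.1 hz)
    exact (hu1 x hx).1
  · intro z hz
    obtain ⟨x, hx, rfl⟩ := Finset.mem_image.1 (Finset.mem_coe.1 hz)
    exact (hu1 x hx).2

theorem Matrix.isHermitian_algebraMap_real {n : ℕ} (x : ℝ) :
    (algebraMap ℝ (Matrix (Fin n) (Fin n) ℂ) x).IsHermitian :=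
  (IsSelfAdjoint.all x).algebraMap _

theorem IsMatrixMonotoneOn.monotoneOn {m : ℕ} {I : Set ℝ} {f : ℝ → ℝ}
    (hf : IsMatrixMonotoneOn (m + 1) I f) : MonotoneOn f I := by
  intro x hx y hy hxy
  have hle : algebraMap ℝ (Matrix (Fin (m + 1)) (Fin (m + 1)) ℂ) x ≤ algebraMap ℝ _ y := by
    rw [Matrix.le_iff, ← map_sub, Algebra.algebraMap_eq_smul_one]
    exact Matrix.PosSemidef.one.smul (sub_nonneg.2 hxy)
  have := Matrix.re_apply_self_mono (hf _ _ (Matrix.isHermitian_algebraMap_real x)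
    (Matrix.isHermitian_algebraMap_real y)
    (by rw [spectrum.scalar_eq]; simpa using hx) (by rw [spectrum.scalar_eq]; simpa using hy)
    hle) 0
  rw [cfc_algebraMap, cfc_algebraMap] at this
  simpa [Matrix.algebraMap_matrix_apply] using this

theorem IsMatrixConvexOn.convexOn {m : ℕ} {I : Set ℝ} (hI : I.OrdConnected) {f : ℝ → ℝ}
    (hf : IsMatrixConvexOn (m + 1) I f) : ConvexOn ℝ I f := by
  refine ⟨hI.convex, fun x hx y hy a b ha hb hab => ?_⟩
  obtain rfl : b = 1 - a := by linarith
  have := Matrix.re_apply_self_mono (hf _ _ (Matrix.isHermitian_algebraMap_real x)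
    (Matrix.isHermitian_algebraMap_real y)
    (by rw [spectrum.scalar_eq]; simpa using hx) (by rw [spectrum.scalar_eq]; simpa using hy)
    a ha (by linarith)) 0
  rw [cfc_algebraMap, cfc_algebraMap, ← algebraMap_smul ℝ a, ← algebraMap_smul ℝ (1 - a)] at this
  have e : a • algebraMap ℝ (Matrix (Fin (m + 1)) (Fin (m + 1)) ℂ) x +
      (1 - a) • algebraMap ℝ (Matrix (Fin (m + 1)) (Fin (m + 1)) ℂ) y =
      algebraMap ℝ _ (a * x + (1 - a) * y) := by
    simp only [map_add, map_mul, Algebra.smul_def]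
  simp only [Algebra.algebraMap_self, RingHom.id_apply] at this
  rw [e, cfc_algebraMap] at this
  simpa [Matrix.algebraMap_matrix_apply] using this

theorem MonotoneOn.exists_one_sided_limit {I : Set ℝ} (hI : IsOpen I) {f : ℝ → ℝ}
    (hf : MonotoneOn f I) {x : ℝ} (hx : x ∈ I) (c : ℝ) : ∃ L, c * L ≤ c * f x ∧
      (Filter.Tendsto f (nhdsWithin x (Set.Iio x)) (nhds L) ∨
        Filter.Tendsto f (nhdsWithin x (Set.Ioi x)) (nhds L)) := by
  obtain ⟨ε, hε, hsub⟩ := exists_Icc_subset_of_isOpen hI hx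
  have hJ := hf.mono hsub
  have hle : x - ε ≤ x + ε := by linarith
  obtain ⟨g, hg, hfg⟩ := hJ.exists_monotone_extension
    (hJ.map_bddBelow Set.Subset.rfl ⟨x - ε, fun y hy => hy.1, Set.left_mem_Icc.2 hle⟩)
    (hJ.map_bddAbove Set.Subset.rfl ⟨x + ε, fun y hy => hy.2, Set.right_mem_Icc.2 hle⟩)
  have hnhds : Set.Icc (x - ε) (x + ε) ∈ nhds x := Icc_mem_nhds (by linarith) (by linarith)
  have heq : ∀ U : Set ℝ, g =ᶠ[nhdsWithin x U] f := fun U =>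
    Filter.mem_of_superset (mem_nhdsWithin_of_mem_nhds hnhds) fun y hy => (hfg hy).symm
  rw [hfg (mem_of_mem_nhds hnhds)]
  rcases le_total 0 c with hc | hc
  · exact ⟨_, mul_le_mul_of_nonneg_left (hg.leftLim_le le_rfl) hc,
      Or.inl ((hg.tendsto_leftLim x).congr' (heq _))⟩
  · exact ⟨_, mul_le_mul_of_nonpos_left (hg.le_rightLim le_rfl) hc,
      Or.inr ((hg.tendsto_rightLim x).congr' (heq _))⟩

theorem IsMatrixMonotoneOn.isToneOn {m : ℕ} {I : Set ℝ} (hIo : IsOpen I) (hIc : I.OrdConnected)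
    {f : ℝ → ℝ} (hf : IsMatrixMonotoneOn (m + 1) I f) : IsToneOn (2 * m + 1) I f :=
  hf.hasPositiveDifferences.isToneOn hIo hIc
    (fun _ _ hab => (hf.monotoneOn.mono hab).integrableOn_isCompact isCompact_Icc)
    fun _ hx c => hf.monotoneOn.exists_one_sided_limit hIo hx c

theorem IsMatrixConvexOn.isToneOn {m : ℕ} {I : Set ℝ} (hIo : IsOpen I) (hIc : I.OrdConnected)
    {f : ℝ → ℝ} (hf : IsMatrixConvexOn (m + 1) I f) : IsToneOn (2 * m + 2) I f := by
  have hcont := (hf.convexOn hIc).continuousOn hIo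
  exact hf.hasPositiveDifferences.isToneOn hIo hIc
    (fun _ _ hab => (hcont.mono hab).integrableOn_Icc)
    fun x hx c => ⟨f x, le_rfl, Or.inl
      ((hcont.continuousAt (hIo.mem_nhds hx)).tendsto.mono_left nhdsWithin_le_nhds)⟩

theorem ConvexOn.ae_differentiableAt {I : Set ℝ} (hI : IsOpen I) {g : ℝ → ℝ}
    (hg : ConvexOn ℝ I g) : ∀ᵐ t, t ∈ I → DifferentiableAt ℝ g t := by
  rw [ae_iff]
  refine measure_null_of_locally_null _ fun x hx => ?_
  have hxI : x ∈ I := by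
    by_contra h
    exact hx fun h' => (h h').elim
  obtain ⟨K, t, ht, hlip⟩ := hg.locallyLipschitzOn hI hxI
  rw [hI.nhdsWithin_eq hxI] at ht
  obtain ⟨u, hut, hu, hxu⟩ := mem_nhds_iff.1 ht
  have hnull : volume {y | ¬(y ∈ u → DifferentiableAt ℝ g y)} = 0 := by
    rw [← ae_iff]
    filter_upwards [(hlip.mono hut).ae_differentiableWithinAt_of_mem_real] with y hy hyu
    exact (hy hyu).differentiableAt (hu.mem_nhds hyu)
  refine ⟨{y | ¬(y ∈ I → DifferentiableAt ℝ g y)} ∩ u,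
    inter_mem_nhdsWithin _ (hu.mem_nhds hxu), measure_mono_null ?_ hnull⟩
  rintro y ⟨hy, hyu⟩
  exact fun h => hy fun _ => h hyu

/-- A convex function on an open interval is twice differentiable almost everywhere. -/
theorem ConvexOn.ae_hasDerivWithinAt_deriv {I : Set ℝ} (hI : IsOpen I) {g : ℝ → ℝ}
    (hg : ConvexOn ℝ I g) : ∀ᵐ t, t ∈ I → DifferentiableAt ℝ g t ∧
      ∃ c : ℝ, 0 ≤ c ∧ HasDerivWithinAt (deriv g) c {s | s ∈ I ∧ DifferentiableAt ℝ g s} t := by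
  have hmono : MonotoneOn (deriv g) {s | s ∈ I ∧ DifferentiableAt ℝ g s} :=
    fun x hx y hy hxy => by
      rcases hxy.eq_or_lt with rfl | hlt
      · exact le_rfl
      · exact (hg.deriv_le_slope hx.1 hy.1 hlt hx.2).trans (hg.slope_le_deriv hx.1 hy.1 hlt hy.2)
  filter_upwards [hg.ae_differentiableAt hI, hmono.ae_differentiableWithinAt_of_mem]
    with t ht h't htI
  exact ⟨ht htI, _, hmono.derivWithin_nonneg, (h't ⟨htI, ht htI⟩).hasDerivWithinAt⟩

/-- `I` is an arbitrary open interval, bounded or not. In the last clause of the monotone case,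
`iteratedDeriv (2 * n - 2) f` is the derivative of `f^(2n-3)`; it exists on the set of points where
`f^(2n-3)` is differentiable, and `f^(2n-1)` is its derivative relative to that set. -/
theorem corollary1p6 (n : ℕ) (hn : 2 ≤ n) (I : Set ℝ) (hI_open : IsOpen I)
    (hI_conn : I.OrdConnected) (f : ℝ → ℝ) :
    (IsMatrixMonotoneOn n I f →
      IsToneOn (2 * n - 1) I f ∧
      ContDiffOn ℝ ((2 * n - 3 : ℕ) : WithTop ℕ∞) f I ∧
      ConvexOn ℝ I (iteratedDeriv (2 * n - 3) f) ∧
      ∀ᵐ t ∂(volume : Measure ℝ), t ∈ I →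
        DifferentiableAt ℝ (iteratedDeriv (2 * n - 3) f) t ∧
        ∃ c : ℝ, 0 ≤ c ∧
          HasDerivWithinAt (iteratedDeriv (2 * n - 2) f) c
            {s | s ∈ I ∧ DifferentiableAt ℝ (iteratedDeriv (2 * n - 3) f) s} t) ∧
    (IsMatrixConvexOn n I f →
      IsToneOn (2 * n) I f ∧
      ContDiffOn ℝ ((2 * n - 2 : ℕ) : WithTop ℕ∞) f I) := by
  obtain ⟨m, rfl⟩ : ∃ m, n = m + 2 := ⟨n - 2, by omega⟩
  rw [show 2 * (m + 2) - 1 = 2 * (m + 1) + 1 by omega,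
    show 2 * (m + 2) - 3 = 2 * m + 1 by omega,
    show 2 * (m + 2) - 2 = 2 * m + 1 + 1 by omega,
    show 2 * (m + 2) = 2 * (m + 1) + 2 by omega]
  refine ⟨fun hf => ?_, fun hf => ?_⟩
  · have htone : IsToneOn (2 * (m + 1) + 1) I f := hf.isToneOn hI_open hI_conn
    obtain ⟨hC, hconv⟩ := IsToneOn.contDiffOn_and_convexOn (m := 2 * m + 1) hI_open hI_conn htone
    refine ⟨htone, hC, hconv, ?_⟩
    rw [iteratedDeriv_succ (n := 2 * m + 1)]
    exact hconv.ae_hasDerivWithinAt_deriv hI_open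
  · have htone : IsToneOn (2 * (m + 1) + 2) I f := hf.isToneOn hI_open hI_conn
    exact ⟨htone,
      (IsToneOn.contDiffOn_and_convexOn (m := 2 * m + 1 + 1) hI_open hI_conn htone).1⟩
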